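/- Let $m,N\ge 1$, let $f:[a,b]\to\mathbb R$ be continuous. For $X=(a_{00},x_0,\xi_1,x_1,\dots,\xi_{N-1},x_{N-1})\in\mathbb R^{(m+1)N}$ with $x_i=(a_{i1},\dots,a_{im})$, put $\xi_0=a$, $\xi_N=b$ and \[ s[X](t)=a_{00}+\sum_{i=0}^{N-1}\sum_{j=1}^m a_{ij}(t-\xi_i)_+^{m+1-j},\qquad P_l(X,t)=a_{00}+\sum_{i=0}^{l-1}\sum_{j=1}^m a_{ij}(t-\xi_i)^{m+1-j}\quad(1\le l\le N), \] $\psi(X,t)=s[X](t)-f(t)$ and $\Psi(X)=\sup_{t\in[a,b]}|\psi(X,t)|$, the objective function of the free-knot continuous spline Chebyshev approximation problem. Fix $X$ with $\xi_0<\xi_1<\dots<\xi_N$. A point $t\in[a,b]$ is extreme if $|\psi(X,t)|=\Psi(X)$; let $K^{\pm}=\{t\in[a,b]:\psi(X,t)=\pm\Psi(X)\}$. An internal knot $\xi_l$ ($1\le l\le N-1$) is a min-knot, neutral knot or max-knot if $a_{lm}<0$, $=0$ or $>0$. An extreme point is an unstable knot if it is a min-knot in $K^+$ or a max-knot in $K^-$;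 it is a stable knot if it is a max-knot in $K^+$ or a min-knot in $K^-$. Let $\beta_j(X,t)=\operatorname{sign}(\psi(X,t))\,\nabla_XP_j(X,t)$ and, for an unstable knot $\xi_l$, $\Delta_l=\mathrm{co}\{\beta_l(X,\xi_l),\beta_{l+1}(X,\xi_l)\}$. Let $\mathcal S$ be the set of all $\beta_j(X,t)$ with $t$ an extreme point that is not an internal knot, or is a neutral or stable knot, and $t\in[\xi_{j-1},\xi_j]$ (for a knot, both adjacent $j$ are used). Let $\mathcal U$ be the set of indices $l$ of unstable knots. For $0\le p<q\le N$ let $\mathcal S_p^q$ be the set of those $\beta_j(X,t)$ that arise from such $t\in[\xi_p,\xi_q]$, and $\mathcal U_p^q=\{l\in\mathcal U:\xi_l\in(\xi_p,\xi_q)\}$. With Minkowski sums (an empty sum being $\{0\}$) put \[ \overline\partial\Psi=\sum_{l\in\mathcal U}\Delta_l,\qquad \underline\partial\Psi=\mathrm{co}\Big\{\mathcal S-\overline\partial\Psi,\ \bigcup_{l\in\mathcal U}\Big(-\sum_{k\in\mathcal U,\,k\ne l}\Delta_k\Big)\Big\}, \] and let $\overline{\partial_p^q}\Psi,\underline{\partial_p^q}\Psi$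 be the sets given by the same formulas with $\mathcal S_p^q,\mathcal U_p^q$ in place of $\mathcal S,\mathcal U$. The spline $s[X]$ is called inf-stationary if $-\overline\partial\Psi\subset\underline\partial\Psi$, and $[\xi_p,\xi_q]$ is called stationary if $-\overline{\partial_p^q}\Psi\subset\underline{\partial_p^q}\Psi$. Then: (1) $s[X]$ is inf-stationary if and only if there are $0\le p<q\le N$ such that $[\xi_p,\xi_q]$ is stationary. (2) Let $[A,B]$ be any quasidifferential of $\Psi$ at $X$ in the sense of Demyanov and Rubinov (that is, $\Psi$ is Lipschitz near $X$, $A,B$ are nonempty, convex and compact, and for every $g$ the one-sided directional derivative $\Psi'(X,g)$ exists and equals $\max_{\mu\in A}\langle\mu,g\rangle+\min_{\nu\in B}\langle\nu,g\rangle$). If there is a stationary subinterval $[\xi_p,\xi_q]$, then $-B\subset A$. Conversely, if the pair $[\underline\partial\Psi,\overline\partial\Psi]$ above is itself a quasidifferential of $\Psi$ at $X$ in this sense and $-B\subset A$, then there is a stationary subinterval $[\xi_p,\xi_q]$ with $0\le p<q\le N$. -/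

import Mathlib

open Set Filter Topology
open scoped Pointwise

noncomputable section

namespace FreeKnotSpline

/-! ### Quasidifferentials in the sense of Demyanov and Rubinov -/

/-- `[A, B]` is a quasidifferential of `F` at `x`: `F` is Lipschitz near `x`, the sets `A`
(subdifferential) and `B` (superdifferential) are nonempty, convex and compact, and every
one-sided directional derivative `F'(x, g)` exists and equals
`max_{μ ∈ A} ⟪μ, g⟫ + min_{ν ∈ B} ⟪ν, g⟫`. -/
def IsQuasidifferential {E : Type*} [NormedAddCommGroup E] [InnerProductSpace ℝ E]
    (F : E → ℝ) (x : E) (A B : Set E) : Prop :=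
  (∃ K : NNReal, ∃ V ∈ 𝓝 x, LipschitzOnWith K F V) ∧
  (A.Nonempty ∧ Convex ℝ A ∧ IsCompact A) ∧
  (B.Nonempty ∧ Convex ℝ B ∧ IsCompact B) ∧
  ∀ g : E, Tendsto (fun α : ℝ => α⁻¹ * (F (x + α • g) - F x)) (𝓝[>] 0)
    (𝓝 (sSup ((fun μ => inner ℝ μ g) '' A) + sInf ((fun ν => inner ℝ ν g) '' B)))

/-! ### Continuous splines of degree `m` with free knots -/

/-- The parameter space `ℝ^((m+1)N)`. A parameter
`X = (a₀₀, x₀, ξ₁, x₁, …, ξ_{N-1}, x_{N-1})`, `xᵢ = (aᵢ₁, …, aᵢₘ)`, is stored in `N` blocks of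
length `m + 1`: `X (0, 0) = a₀₀`, `X (i, 0) = ξᵢ` for `1 ≤ i < N`, and `X (i, j) = aᵢⱼ`
for `1 ≤ j ≤ m`. -/
abbrev Param (m N : ℕ) : Type := EuclideanSpace ℝ (Fin N × Fin (m + 1))

variable {m N : ℕ}

/-- The knots `ξ₀ = a`, `ξ₁, …, ξ_{N-1}` (read off from `X`), `ξ_N = b`. -/
def knot (a b : ℝ) (X : Param m N) (l : ℕ) : ℝ :=
  if l = 0 then a else if h : l < N then X (⟨l, h⟩, 0) else b

/-- The truncated power `(t - τ)₊^k`. -/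
def truncPow (t τ : ℝ) (k : ℕ) : ℝ := if t < τ then 0 else (t - τ) ^ k

/-- The spline `s[X](t) = a₀₀ + ∑_{i=0}^{N-1} ∑_{j=1}^{m} aᵢⱼ (t - ξᵢ)₊^{m+1-j}`. The index
`j : Fin m` stands for `j + 1`, so the exponent reads `m - j`. -/
def spline [NeZero N] (a b : ℝ) (X : Param m N) (t : ℝ) : ℝ :=
  X (0, 0) + ∑ i : Fin N, ∑ j : Fin m, X (i, j.succ) * truncPow t (knot a b X i) (m - j)

/-- The polynomial `P_l(X, t) = a₀₀ + ∑_{i=0}^{l-1} ∑_{j=1}^{m} aᵢⱼ (t - ξᵢ)^{m+1-j}`, with which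
the spline coincides on `[ξ_{l-1}, ξ_l]`, `1 ≤ l ≤ N`. -/
def piece [NeZero N] (a b : ℝ) (l : ℕ) (X : Param m N) (t : ℝ) : ℝ :=
  X (0, 0) + ∑ i : Fin N with i.val < l, ∑ j : Fin m,
    X (i, j.succ) * (t - knot a b X i) ^ (m - j : ℕ)

/-- The deviation `ψ(X, t) = s[X](t) - f(t)`. -/
def deviation [NeZero N] (a b : ℝ) (f : ℝ → ℝ) (X : Param m N) (t : ℝ) : ℝ :=
  spline a b X t - f t

/-- The objective function `Ψ(X) = sup_{t ∈ [a, b]} max {s[X](t) - f(t), -s[X](t) + f(t)}`. -/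
def objective [NeZero N] (a b : ℝ) (f : ℝ → ℝ) (X : Param m N) : ℝ :=
  ⨆ t : Icc a b, max (deviation a b f X t) (-deviation a b f X t)

/-- Extreme points with positive deviation. -/
def Kpos [NeZero N] (a b : ℝ) (f : ℝ → ℝ) (X : Param m N) : Set ℝ :=
  {t ∈ Icc a b | deviation a b f X t = objective a b f X}

/-- Extreme points with negative deviation. -/
def Kneg [NeZero N] (a b : ℝ) (f : ℝ → ℝ) (X : Param m N) : Set ℝ :=
  {t ∈ Icc a b | deviation a b f X t = -objective a b f X}

/-- The coefficient `a_{lm}` of `(t - ξ_l)₊`, which gives the jump of `s'` at `ξ_l`. -/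
def jump (X : Param m N) (l : ℕ) : ℝ :=
  if h : l < N then X (⟨l, h⟩, Fin.last m) else 0

/-- The neutral internal knots. -/
def Eneutral (a b : ℝ) (X : Param m N) : Set ℝ :=
  {t | ∃ l, 1 ≤ l ∧ l < N ∧ t = knot a b X l ∧ jump X l = 0}

/-- The max-knots. -/
def Emax (a b : ℝ) (X : Param m N) : Set ℝ :=
  {t | ∃ l, 1 ≤ l ∧ l < N ∧ t = knot a b X l ∧ 0 < jump X l}

/-- The min-knots. -/
def Emin (a b : ℝ) (X : Param m N) : Set ℝ :=
  {t | ∃ l, 1 ≤ l ∧ l < N ∧ t = knot a b X l ∧ jump X l < 0}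

/-- The extreme points that are not internal knots. -/
def Esmooth [NeZero N] (a b : ℝ) (f : ℝ → ℝ) (X : Param m N) : Set ℝ :=
  {t ∈ Kpos a b f X ∪ Kneg a b f X | ∀ l, 1 ≤ l → l < N → t ≠ knot a b X l}

/-- `β_j(X, t) = sign(ψ(X, t)) ∇_X P_j(X, t)`. -/
def beta [NeZero N] (a b : ℝ) (f : ℝ → ℝ) (X : Param m N) (j : ℕ) (t : ℝ) : Param m N :=
  Real.sign (deviation a b f X t) • gradient (fun Y : Param m N => piece a b j Y t) X

/-- The extreme points that are not internal knots, or are neutral or stable knots. -/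
def stablePoints [NeZero N] (a b : ℝ) (f : ℝ → ℝ) (X : Param m N) : Set ℝ :=
  Esmooth a b f X ∪ ((Kpos a b f X ∪ Kneg a b f X) ∩ Eneutral a b X) ∪
    (Kpos a b f X ∩ Emax a b X) ∪ (Kneg a b f X ∩ Emin a b X)

/-- The vectors `β_j(X, t)`, where `t` runs through the elements of `T` that are extreme points
and not unstable knots, and `[ξ_{j-1}, ξ_j]` through the intervals that contain `t`
(both adjacent intervals, if `t` is an internal knot). -/
def gradSet [NeZero N] (a b : ℝ) (f : ℝ → ℝ) (X : Param m N) (T : Set ℝ) : Set (Param m N) :=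
  {v | ∃ t ∈ stablePoints a b f X ∩ T, ∃ j, 1 ≤ j ∧ j ≤ N ∧
    t ∈ Icc (knot a b X (j - 1)) (knot a b X j) ∧ v = beta a b f X j t}

open Classical in
/-- The indices of the extreme points in `T` that are unstable (internal) knots. -/
def unstableIdx [NeZero N] (a b : ℝ) (f : ℝ → ℝ) (X : Param m N) (T : Set ℝ) : Finset ℕ :=
  {l ∈ Finset.Ico 1 N | knot a b X l ∈ T ∧
    knot a b X l ∈ (Kpos a b f X ∩ Emin a b X) ∪ (Kneg a b f X ∩ Emax a b X)}

/-- `Δ_l = co {β_l(X, ξ_l), β_{l+1}(X, ξ_l)}`. -/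
def Delta [NeZero N] (a b : ℝ) (f : ℝ → ℝ) (X : Param m N) (l : ℕ) : Set (Param m N) :=
  convexHull ℝ {beta a b f X l (knot a b X l), beta a b f X (l + 1) (knot a b X l)}

/-- `∑_{l ∈ U} Δ_l` (Minkowski sum; `{0}` if `U` is empty). -/
def superOf [NeZero N] (a b : ℝ) (f : ℝ → ℝ) (X : Param m N) (U : Finset ℕ) : Set (Param m N) :=
  ∑ l ∈ U, Delta a b f X l

/-- `co {S - ∑_{k ∈ U} Δ_k, ⋃_{l ∈ U} (-∑_{k ∈ U, k ≠ l} Δ_k)}`. -/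
def subOf [NeZero N] (a b : ℝ) (f : ℝ → ℝ) (X : Param m N) (S : Set (Param m N))
    (U : Finset ℕ) : Set (Param m N) :=
  convexHull ℝ ((S - superOf a b f X U) ∪ ⋃ l ∈ U, -superOf a b f X (U.erase l))

/-- The superdifferential `∂̄Ψ(X)`. -/
def superdiff [NeZero N] (a b : ℝ) (f : ℝ → ℝ) (X : Param m N) : Set (Param m N) :=
  superOf a b f X (unstableIdx a b f X univ)

/-- The subdifferential `∂̲Ψ(X)`. -/
def subdiff [NeZero N] (a b : ℝ) (f : ℝ → ℝ) (X : Param m N) : Set (Param m N) :=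
  subOf a b f X (gradSet a b f X univ) (unstableIdx a b f X univ)

/-- `s[X]` is inf-stationary: `-∂̄Ψ(X) ⊆ ∂̲Ψ(X)`. -/
def InfStationary [NeZero N] (a b : ℝ) (f : ℝ → ℝ) (X : Param m N) : Prop :=
  -superdiff a b f X ⊆ subdiff a b f X

/-- The superdifferential confined to `[ξ_p, ξ_q]`; it uses the unstable knots in the open
interval. -/
def confinedSuperdiff [NeZero N] (a b : ℝ) (f : ℝ → ℝ) (X : Param m N) (p q : ℕ) :
    Set (Param m N) :=
  superOf a b f X (unstableIdx a b f X (Ioo (knot a b X p) (knot a b X q)))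

/-- The subdifferential confined to `[ξ_p, ξ_q]`; it uses the other extreme points in the closed
interval and the unstable knots in the open interval. -/
def confinedSubdiff [NeZero N] (a b : ℝ) (f : ℝ → ℝ) (X : Param m N) (p q : ℕ) :
    Set (Param m N) :=
  subOf a b f X (gradSet a b f X (Icc (knot a b X p) (knot a b X q)))
    (unstableIdx a b f X (Ioo (knot a b X p) (knot a b X q)))

/-- The interval `[ξ_p, ξ_q]` is stationary. -/
def StationaryInterval [NeZero N] (a b : ℝ) (f : ℝ → ℝ) (X : Param m N) (p q : ℕ) : Prop :=
  -confinedSuperdiff a b f X p q ⊆ confinedSubdiff a b f X p q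

end FreeKnotSpline

end

/-! Part (1) is monotonicity of an inclusion of Minkowski sums. If `-∑_{U} Δ ⊆ co(...)` holds for
the data confined to `[ξ_p, ξ_q]`, subtract the remaining `Δ_k` from both sides. A convex summand
passes inside a convex hull, so the generators become generators of the full subdifferential
(`neg_superOf_subset_subOf_mono`). Conversely, `[ξ_0, ξ_N]` is the whole interval.

Part (2) rests on the fact that, for any quasidifferential, `-B ⊆ A` says exactly that all one-sided
directional derivatives are nonnegative. This condition does not depend on the choice of the pair,
so it transfers between quasidifferentials. For the first implication the explicit pair need not be
a quasidifferential: lower bounds for the derivative `L` along `g` suffice. Each `β` in the stable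
set satisfies `⟪β, g⟫ ≤ L`, and each unstable knot gives `min ⟪·, g⟫ ≤ L` over `Δ_l`. Testing the
inclusion at the sum of the minimizers yields `0 ≤ L` (`InfStationary.derivative_nonneg`). -/

namespace FreeKnotSpline

/-! ### Quasidifferentials and the sign of directional derivatives. -/

section Quasidifferential

variable {E : Type*} [NormedAddCommGroup E] [InnerProductSpace ℝ E]

/-- If the one-sided directional derivatives of `F` at `x` are all nonnegative, every
quasidifferential `[A, B]` of `F` at `x` satisfies `-B ⊆ A`. -/
theorem IsQuasidifferential.neg_subset [CompleteSpace E] {F : E → ℝ} {x : E} {A B : Set E}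
    (h : IsQuasidifferential F x A B)
    (hF : ∀ g : E, ∀ L : ℝ,
      Tendsto (fun α : ℝ => α⁻¹ * (F (x + α • g) - F x)) (𝓝[>] 0) (𝓝 L) → 0 ≤ L) :
    -B ⊆ A := by
  obtain ⟨-, ⟨hAne, hAconv, hAcomp⟩, ⟨hBne, hBconv, hBcomp⟩, hlim⟩ := h
  intro w hw
  by_contra hwA
  -- Along the Riesz representative of a functional separating `w` from `A`, the derivative is at
  -- most `u - φ w < 0`.
  obtain ⟨φ, u, hφA, hφw⟩ := geometric_hahn_banach_closed_point hAconv hAcomp.isClosed hwA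
  set g : E := (InnerProductSpace.toDual ℝ E).symm φ
  have hg : ∀ y : E, inner ℝ y g = φ y := fun y => by
    rw [real_inner_comm]; exact InnerProductSpace.toDual_symm_apply
  have h0 := hF g _ (hlim g)
  have hA : sSup ((fun μ => inner ℝ μ g) '' A) ≤ u := by
    refine csSup_le (hAne.image _) ?_
    rintro _ ⟨μ, hμ, rfl⟩
    simpa only [hg] using (hφA μ hμ).le
  have hB : sInf ((fun ν => inner ℝ ν g) '' B) ≤ -φ w := by
    refine csInf_le (hBcomp.image (by fun_prop)).bddBelow ⟨-w, hw, ?_⟩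
    simp only [hg, map_neg]
  linarith

/-- For each `ν ∈ B`, the vector `-ν` competes in the maximum over `A`, so the maximum is at least
`-⟪ν, g⟫`. -/
theorem IsQuasidifferential.derivative_nonneg {F : E → ℝ} {x : E} {A B : Set E}
    (h : IsQuasidifferential F x A B) (hBA : -B ⊆ A) {g : E} {L : ℝ}
    (hL : Tendsto (fun α : ℝ => α⁻¹ * (F (x + α • g) - F x)) (𝓝[>] 0) (𝓝 L)) : 0 ≤ L := by
  obtain ⟨-, ⟨-, -, hAcomp⟩, ⟨hBne, -, -⟩, hlim⟩ := h
  rw [tendsto_nhds_unique hL (hlim g), ← neg_le_iff_add_nonneg']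
  refine le_csInf (hBne.image _) ?_
  rintro _ ⟨ν, hν, rfl⟩
  have hmem : -ν ∈ A := hBA (Set.neg_mem_neg.2 hν)
  have := le_csSup (hAcomp.image (f := fun μ => inner ℝ μ g) (by fun_prop)).bddAbove
    (mem_image_of_mem _ hmem)
  simp only [inner_neg_left] at this
  linarith

end Quasidifferential

/-! ### Knots, truncated powers and the jump of the first derivative. -/

section Knots

variable {m N : ℕ} {a b : ℝ} {X : Param m N}

theorem knot_zero : knot a b X 0 = a := by simp [knot]

theorem knot_lt_knot (hknots : ∀ l, l < N → knot a b X l < knot a b X (l + 1)) {i j : ℕ}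
    (hij : i < j) (hj : j ≤ N) : knot a b X i < knot a b X j := by
  induction j, hij using Nat.le_induction with
  | base => exact hknots i hj
  | succ j hij ih => exact (ih (by omega)).trans (hknots j hj)

theorem knot_le_knot (hknots : ∀ l, l < N → knot a b X l < knot a b X (l + 1)) {i j : ℕ}
    (hij : i ≤ j) (hj : j ≤ N) : knot a b X i ≤ knot a b X j := by
  rcases hij.eq_or_lt with rfl | h
  exacts [le_rfl, (knot_lt_knot hknots h hj).le]

@[fun_prop]
theorem continuous_knot (l : ℕ) : Continuous fun Y : Param m N => knot a b Y l := by
  unfold knot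
  split_ifs <;> fun_prop

@[fun_prop]
theorem differentiable_knot (l : ℕ) : Differentiable ℝ fun Y : Param m N => knot a b Y l := by
  unfold knot
  split_ifs <;> fun_prop

theorem continuous_truncPow (τ : ℝ) {k : ℕ} (hk : k ≠ 0) :
    Continuous fun t => truncPow t τ k := by
  have : (fun t => truncPow t τ k) = fun t => (max (t - τ) 0) ^ k := by
    funext t
    unfold truncPow
    split_ifs with h
    · rw [max_eq_right (by linarith), zero_pow hk]
    · rw [max_eq_left (by linarith)]
  rw [this]
  fun_prop

/-- The quotient of `P_{k+1}(Y, t) - P_k(Y, t)` by `t - ξ_k`. -/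
def slope (a b : ℝ) (k : Fin N) (Y : Param m N) (t : ℝ) : ℝ :=
  ∑ j : Fin m, Y (k, j.succ) * (t - knot a b Y k) ^ (m - 1 - j : ℕ)

@[fun_prop]
theorem differentiable_slope (k : Fin N) (t : ℝ) :
    Differentiable ℝ fun Y : Param m N => slope a b k Y t := by
  unfold slope
  fun_prop

/-- Only the term with exponent zero survives at the knot. By continuity, the sign of the jump then
controls the sign of `slope` near `X`. -/
theorem slope_knot (hm : 1 ≤ m) (k : Fin N) : slope a b k X (knot a b X k) = jump X k := by
  obtain ⟨n, rfl⟩ : ∃ n, m = n + 1 := ⟨m - 1, by omega⟩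
  unfold slope jump
  rw [dif_pos k.2, Finset.sum_eq_single (Fin.last n)]
  · simp
  · intro j _ hj
    have : j.val < n := Fin.val_lt_last hj
    rw [sub_self, zero_pow (by omega), mul_zero]
  · simp

end Knots

variable {m N : ℕ} [NeZero N] {a b : ℝ} {f : ℝ → ℝ} {X : Param m N}

/-! ### Minkowski sums and confinement to subintervals. -/

theorem convex_superOf (U : Finset ℕ) : Convex ℝ (superOf a b f X U) :=
  convex_sum _ fun _ _ => convex_convexHull ℝ _

theorem superOf_add_sdiff {U V : Finset ℕ} (h : U ⊆ V) :
    superOf a b f X U + superOf a b f X (V \ U) = superOf a b f X V := by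
  rw [add_comm]; exact Finset.sum_sdiff h

theorem neg_superOf_subset_subOf_mono {S S' : Set (Param m N)} {U V : Finset ℕ} (hS : S ⊆ S')
    (hU : U ⊆ V) (h : -superOf a b f X U ⊆ subOf a b f X S U) :
    -superOf a b f X V ⊆ subOf a b f X S' V := by
  have hR : Convex ℝ (-superOf a b f X (V \ U)) := (convex_superOf _).neg
  rw [← superOf_add_sdiff hU, neg_add]
  refine (add_subset_add_right h).trans ?_
  unfold subOf
  -- Since `co P + co Q = co (P + Q)`, it remains to compare generators.
  rw [← hR.convexHull_eq, ← convexHull_add]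
  refine convexHull_mono ?_
  rw [union_add]
  refine union_subset_union ?_ ?_
  · rw [← sub_eq_add_neg, sub_sub, superOf_add_sdiff hU]
    exact sub_subset_sub_right hS
  · rw [iUnion₂_add]
    refine iUnion₂_subset fun l hl => ?_
    have hsub : U.erase l ⊆ V.erase l := Finset.erase_subset_erase l hU
    have hd : V.erase l \ U.erase l = V \ U := by
      ext i; simp only [Finset.mem_sdiff, Finset.mem_erase]; grind
    rw [← neg_add, ← hd, superOf_add_sdiff hsub]
    exact subset_iUnion₂_of_subset l (hU hl) subset_rfl

theorem gradSet_mono {T T' : Set ℝ} (h : T ⊆ T') : gradSet a b f X T ⊆ gradSet a b f X T' := by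
  rintro v ⟨t, ⟨ht, htT⟩, hv⟩
  exact ⟨t, ⟨ht, h htT⟩, hv⟩

theorem unstableIdx_mono {T T' : Set ℝ} (h : T ⊆ T') :
    unstableIdx a b f X T ⊆ unstableIdx a b f X T' := by
  intro l hl
  simp only [unstableIdx, Finset.mem_filter] at hl ⊢
  exact ⟨hl.1, h hl.2.1, hl.2.2⟩

theorem StationaryInterval.infStationary {p q : ℕ} (h : StationaryInterval a b f X p q) :
    InfStationary a b f X :=
  neg_superOf_subset_subOf_mono (gradSet_mono (subset_univ _)) (unstableIdx_mono (subset_univ _)) h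

theorem knot_last : knot a b X N = b := by simp [knot, NeZero.ne N]

theorem stablePoints_subset_Icc : stablePoints a b f X ⊆ Icc a b := by
  rintro t (((⟨h | h, -⟩ | ⟨h | h, -⟩) | ⟨h, -⟩) | ⟨h, -⟩) <;> exact h.1

/-- Confinement to `[ξ_0, ξ_N]` discards nothing: extreme points lie in `[a, b]` and internal knots
lie strictly inside it. -/
theorem stationaryInterval_zero_last (hknots : ∀ l, l < N → knot a b X l < knot a b X (l + 1)) :
    StationaryInterval a b f X 0 N ↔ InfStationary a b f X := by
  have hS : gradSet a b f X (Icc (knot a b X 0) (knot a b X N)) = gradSet a b f X univ := by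
    simp only [gradSet, knot_zero, knot_last, inter_univ,
      inter_eq_left.2 (stablePoints_subset_Icc (a := a) (b := b) (f := f) (X := X))]
  have hU : unstableIdx a b f X (Ioo (knot a b X 0) (knot a b X N)) =
      unstableIdx a b f X univ := by
    refine (unstableIdx_mono (subset_univ _)).antisymm fun l hl => ?_
    simp only [unstableIdx, Finset.mem_filter, Finset.mem_Ico] at hl ⊢
    exact ⟨hl.1, ⟨knot_lt_knot hknots (by omega) (by omega),
      knot_lt_knot hknots hl.1.2 le_rfl⟩, hl.2.2⟩
  simp only [StationaryInterval, confinedSuperdiff, confinedSubdiff, InfStationary, superdiff,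
    subdiff, hS, hU]

theorem infStationary_iff (hknots : ∀ l, l < N → knot a b X l < knot a b X (l + 1)) :
    InfStationary a b f X ↔ ∃ p q, p < q ∧ q ≤ N ∧ StationaryInterval a b f X p q :=
  ⟨fun h => ⟨0, N, NeZero.pos N, le_rfl, (stationaryInterval_zero_last hknots).2 h⟩,
    fun ⟨_, _, _, _, h⟩ => h.infStationary⟩

/-! ### Local comparison of the spline with its polynomial pieces. -/

@[fun_prop]
theorem differentiable_piece (l : ℕ) (t : ℝ) :
    Differentiable ℝ fun Y : Param m N => piece a b l Y t := by
  unfold piece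
  fun_prop

theorem continuous_spline (Y : Param m N) : Continuous (spline a b Y) := by
  refine continuous_const.add (continuous_finsetSum _ fun i _ => continuous_finsetSum _ fun j _ =>
    continuous_const.mul (continuous_truncPow _ (by have := j.2; omega)))

theorem spline_eq_piece {Y : Param m N} {t : ℝ} {l : ℕ}
    (h1 : ∀ i < l, i < N → knot a b Y i ≤ t) (h2 : ∀ i < N, l ≤ i → t ≤ knot a b Y i) :
    spline a b Y t = piece a b l Y t := by
  unfold spline piece
  rw [Finset.sum_filter]
  congr 1
  refine Finset.sum_congr rfl fun i _ => ?_
  split_ifs with h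
  · simp only [truncPow, if_neg (h1 i h i.2).not_gt]
  · refine Finset.sum_eq_zero fun j _ => ?_
    -- At equality the truncated power is not cut off, but it vanishes because its exponent is
    -- positive.
    have ht := h2 i i.2 (not_lt.1 h)
    unfold truncPow
    split_ifs with h'
    · simp
    · rw [le_antisymm ht (not_lt.1 h'), sub_self, zero_pow (by have := j.2; omega), mul_zero]

theorem piece_succ (k : Fin N) (Y : Param m N) (t : ℝ) :
    piece a b (k + 1) Y t = piece a b k Y t + (t - knot a b Y k) * slope a b k Y t := by
  have hk : (Finset.univ.filter fun i : Fin N => i.val < k + 1) =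
      insert k (Finset.univ.filter fun i : Fin N => i.val < k) := by
    ext i; simp only [Finset.mem_filter, Finset.mem_insert, Finset.mem_univ, Fin.ext_iff]; grind
  unfold piece slope
  rw [hk, Finset.sum_insert (by simp), add_left_comm, add_comm, Finset.mul_sum]
  congr 1
  refine Finset.sum_congr rfl fun j _ => ?_
  rw [show m - j.val = m - 1 - j.val + 1 by have := j.2; omega, pow_succ]
  ring

theorem eventually_spline_eq_piece {t : ℝ} {l : ℕ} (ht : a ≤ t)
    (h1 : ∀ i, 1 ≤ i → i < l → i < N → knot a b X i < t)
    (h2 : ∀ i < N, l ≤ i → t < knot a b X i) :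
    ∀ᶠ Y in 𝓝 X, spline a b Y t = piece a b l Y t := by
  have e1 : ∀ i : Fin N, ∀ᶠ Y in 𝓝 X, i.val < l → knot a b Y i ≤ t := by
    intro i
    -- The knot `ξ_0 = a` does not move with `Y`, so the weak inequality `a ≤ t` is enough there.
    rcases Nat.eq_zero_or_pos i.val with hi | hi
    · exact Eventually.of_forall fun Y _ => by rwa [hi, knot_zero]
    · by_cases hil : i.val < l
      · filter_upwards [(continuous_knot i.val).continuousAt.eventually_lt_const
          (h1 i hi hil i.2)] with Y hY _ using hY.le
      · exact Eventually.of_forall fun Y h => absurd h hil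
  have e2 : ∀ i : Fin N, ∀ᶠ Y in 𝓝 X, l ≤ i.val → t ≤ knot a b Y i := by
    intro i
    by_cases hil : l ≤ i.val
    · filter_upwards [(continuous_knot i.val).continuousAt.eventually_const_lt
        (h2 i i.2 hil)] with Y hY _ using hY.le
    · exact Eventually.of_forall fun Y h => absurd h hil
  filter_upwards [eventually_all.2 e1, eventually_all.2 e2] with Y h1' h2'
  exact spline_eq_piece (fun i hil hi => h1' ⟨i, hi⟩ hil) fun i hi hil => h2' ⟨i, hi⟩ hil

/-- The evaluation point stays at the unperturbed knot while the knot moves with `Y`; the side to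
which it moves selects the piece. -/
theorem eventually_spline_eq_piece_knot
    (hknots : ∀ l, l < N → knot a b X l < knot a b X (l + 1)) {k : Fin N} :
    ∀ᶠ Y in 𝓝 X,
      (knot a b Y k ≤ knot a b X k ∧
        spline a b Y (knot a b X k) = piece a b (k + 1) Y (knot a b X k)) ∨
      (knot a b X k ≤ knot a b Y k ∧
        spline a b Y (knot a b X k) = piece a b k Y (knot a b X k)) := by
  set t := knot a b X k
  have e1 : ∀ i : Fin N, ∀ᶠ Y in 𝓝 X, i.val < k → knot a b Y i ≤ t := by
    intro i
    by_cases hik : i.val < k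
    · filter_upwards [(continuous_knot i.val).continuousAt.eventually_lt_const
        (knot_lt_knot hknots hik k.2.le)] with Y hY _ using hY.le
    · exact Eventually.of_forall fun Y h => absurd h hik
  have e2 : ∀ i : Fin N, ∀ᶠ Y in 𝓝 X, k.val < i → t ≤ knot a b Y i := by
    intro i
    by_cases hik : k.val < i
    · filter_upwards [(continuous_knot i.val).continuousAt.eventually_const_lt
        (knot_lt_knot hknots hik i.2.le)] with Y hY _ using hY.le
    · exact Eventually.of_forall fun Y h => absurd h hik
  filter_upwards [eventually_all.2 e1, eventually_all.2 e2] with Y h1 h2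
  rcases le_total (knot a b Y k) t with h | h
  · refine Or.inl ⟨h, spline_eq_piece (fun i hik hi => ?_) fun i hi hik => h2 ⟨i, hi⟩ hik⟩
    rcases (Nat.lt_succ_iff.1 hik).eq_or_lt with rfl | hik
    exacts [h, h1 ⟨i, hi⟩ hik]
  · refine Or.inr ⟨h, spline_eq_piece (fun i hik hi => h1 ⟨i, hi⟩ hik) fun i hi hik => ?_⟩
    rcases hik.eq_or_lt with rfl | hik
    exacts [h, h2 ⟨i, hi⟩ hik]

/-- At a max-knot the spline is locally the maximum of the adjacent pieces. -/
theorem eventually_piece_le_spline (hm : 1 ≤ m)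
    (hknots : ∀ l, l < N → knot a b X l < knot a b X (l + 1)) {k : Fin N}
    (hj : 0 < jump X k) :
    ∀ᶠ Y in 𝓝 X, piece a b k Y (knot a b X k) ≤ spline a b Y (knot a b X k) ∧
      piece a b (k + 1) Y (knot a b X k) ≤ spline a b Y (knot a b X k) := by
  have hs : ∀ᶠ Y in 𝓝 X, 0 < slope a b k Y (knot a b X k) :=
    (differentiable_slope k _).continuous.continuousAt.eventually_const_lt
      (by simpa only [slope_knot hm] using hj)
  filter_upwards [hs, eventually_spline_eq_piece_knot hknots] with Y h0 h
  have := piece_succ (a := a) (b := b) k Y (knot a b X k)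
  rcases h with ⟨hle, h⟩ | ⟨hle, h⟩
  · have := mul_nonneg (sub_nonneg.2 hle) h0.le
    constructor <;> linarith
  · have := mul_nonneg (sub_nonneg.2 hle) h0.le
    constructor <;> linarith

/-- At a min-knot the spline is locally the minimum of the adjacent pieces. -/
theorem eventually_spline_le_piece (hm : 1 ≤ m)
    (hknots : ∀ l, l < N → knot a b X l < knot a b X (l + 1)) {k : Fin N}
    (hj : jump X k < 0) :
    ∀ᶠ Y in 𝓝 X, spline a b Y (knot a b X k) ≤ piece a b k Y (knot a b X k) ∧
      spline a b Y (knot a b X k) ≤ piece a b (k + 1) Y (knot a b X k) := by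
  have hs : ∀ᶠ Y in 𝓝 X, slope a b k Y (knot a b X k) < 0 :=
    (differentiable_slope k _).continuous.continuousAt.eventually_lt_const
      (by simpa only [slope_knot hm] using hj)
  filter_upwards [hs, eventually_spline_eq_piece_knot hknots] with Y h0 h
  have := piece_succ (a := a) (b := b) k Y (knot a b X k)
  rcases h with ⟨hle, h⟩ | ⟨hle, h⟩
  · have := mul_nonneg (sub_nonneg.2 hle) (neg_nonneg.2 h0.le)
    constructor <;> linarith
  · have := mul_nonneg (sub_nonneg.2 hle) (neg_nonneg.2 h0.le)
    constructor <;> linarith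

/-- At a neutral knot the gradients of the adjacent pieces coincide. -/
theorem beta_succ_of_jump_eq_zero (hm : 1 ≤ m) (k : Fin N) (hj : jump X k = 0) :
    beta a b f X (k + 1) (knot a b X k) = beta a b f X k (knot a b X k) := by
  unfold beta gradient
  congr 2
  set t := knot a b X k with ht
  have h : (fun Y : Param m N => piece a b (k + 1) Y t) =
      (fun Y => piece a b k Y t) + (fun Y => t - knot a b Y k) * fun Y => slope a b k Y t := by
    funext Y; exact piece_succ k Y t
  -- Both factors of the product vanish at `X`, hence so does its derivative.
  rw [h, fderiv_add (by fun_prop) (DifferentiableAt.mul (by fun_prop) (by fun_prop)),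
    fderiv_mul (by fun_prop) (by fun_prop), slope_knot hm, hj, ← ht]
  simp

/-! ### Lower bounds for the directional derivatives of the objective function. -/

section Derivative

variable {m N : ℕ} [NeZero N] {a b : ℝ} {f : ℝ → ℝ} {X : Param m N}

theorem abs_deviation_le_objective (hf : ContinuousOn f (Icc a b)) (Y : Param m N) {t : ℝ}
    (ht : t ∈ Icc a b) : |deviation a b f Y t| ≤ objective a b f Y := by
  have hc : ContinuousOn (fun t => |deviation a b f Y t|) (Icc a b) :=
    ((continuous_spline Y).continuousOn.sub hf).abs
  obtain ⟨M, hM⟩ := (isCompact_Icc.image_of_continuousOn hc).bddAbove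
  refine le_ciSup (f := fun t : Icc a b => |deviation a b f Y t|) ⟨M, ?_⟩ ⟨t, ht⟩
  rintro _ ⟨s, rfl⟩
  exact hM ⟨s, s.2, rfl⟩

theorem objective_nonneg (Y : Param m N) : 0 ≤ objective a b f Y :=
  Real.iSup_nonneg fun _ => abs_nonneg _

theorem hasDerivAt_piece (l : ℕ) (t : ℝ) (g : Param m N) :
    HasDerivAt (fun α : ℝ => piece a b l (X + α • g) t)
      (inner ℝ (gradient (fun Y : Param m N => piece a b l Y t) X) g) 0 := by
  have hline : HasDerivAt (fun α : ℝ => X + α • g) g 0 := by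
    simpa using ((hasDerivAt_id (0 : ℝ)).smul_const g).const_add X
  have hp : HasFDerivAt (fun Y : Param m N => piece a b l Y t)
      (InnerProductSpace.toDual ℝ _ (gradient (fun Y : Param m N => piece a b l Y t) X))
      (X + (0 : ℝ) • g) := by
    rw [zero_smul, add_zero]
    exact (differentiable_piece l t X).hasGradientAt.hasFDerivAt
  exact hp.comp_hasDerivAt (0 : ℝ) hline

theorem tendsto_piece_quotient (l : ℕ) (t : ℝ) (g : Param m N) :
    Tendsto (fun α : ℝ => α⁻¹ * (Real.sign (deviation a b f X t) * piece a b l (X + α • g) t -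
      Real.sign (deviation a b f X t) * piece a b l X t)) (𝓝[>] 0)
      (𝓝 (inner ℝ (beta a b f X l t) g)) := by
  have h := ((hasDerivAt_piece (a := a) (b := b) (X := X) l t g).const_mul
    (Real.sign (deviation a b f X t))).tendsto_slope_zero_right
  simpa only [zero_add, zero_smul, add_zero, smul_eq_mul, beta, real_inner_smul_left] using h

theorem sign_mul_self_eq_abs (x : ℝ) : Real.sign x * x = |x| := by
  rcases lt_trichotomy x 0 with h | rfl | h
  · rw [Real.sign_of_neg h, abs_of_neg h]; ring
  · simp
  · rw [Real.sign_of_pos h, abs_of_pos h, one_mul]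

theorem sign_mul_le_abs (x y : ℝ) : Real.sign x * y ≤ |y| := by
  rcases Real.sign_apply_eq x with h | h | h <;> rw [h]
  · simpa using neg_le_abs y
  · simp
  · simpa using le_abs_self y

theorem abs_deviation_of_mem {t : ℝ} (ht : t ∈ Kpos a b f X ∪ Kneg a b f X) :
    t ∈ Icc a b ∧ |deviation a b f X t| = objective a b f X := by
  rcases ht with ht | ht
  · exact ⟨ht.1, by rw [ht.2, abs_of_nonneg (objective_nonneg X)]⟩
  · exact ⟨ht.1, by rw [ht.2, abs_neg, abs_of_nonneg (objective_nonneg X)]⟩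

/-- A lower bound for the directional derivative at an extreme point at which the signed spline
is locally bounded below by the minimum of two of the signed pieces. -/
theorem min_inner_beta_le (hf : ContinuousOn f (Icc a b)) {t : ℝ} {l l' : ℕ} {g : Param m N}
    {L : ℝ} (hL : Tendsto (fun α : ℝ => α⁻¹ * (objective a b f (X + α • g) - objective a b f X))
      (𝓝[>] 0) (𝓝 L))
    (ht : t ∈ Kpos a b f X ∪ Kneg a b f X)
    (hl : spline a b X t = piece a b l X t) (hl' : spline a b X t = piece a b l' X t)
    (h : ∀ᶠ Y in 𝓝 X, min (Real.sign (deviation a b f X t) * piece a b l Y t)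
      (Real.sign (deviation a b f X t) * piece a b l' Y t) ≤
        Real.sign (deviation a b f X t) * spline a b Y t) :
    min (inner ℝ (beta a b f X l t) g) (inner ℝ (beta a b f X l' t) g) ≤ L := by
  obtain ⟨htI, habs⟩ := abs_deviation_of_mem ht
  refine le_of_tendsto_of_tendsto
    ((tendsto_piece_quotient l t g).min (tendsto_piece_quotient l' t g)) hL ?_
  have hline : Tendsto (fun α : ℝ => X + α • g) (𝓝[>] 0) (𝓝 X) := by
    have : Continuous fun α : ℝ => X + α • g := by fun_prop
    simpa using (this.tendsto 0).mono_left nhdsWithin_le_nhds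
  filter_upwards [hline.eventually h, self_mem_nhdsWithin] with α hα hpos
  have hpos : 0 < α⁻¹ := inv_pos.2 hpos
  rw [← mul_min_of_nonneg _ _ hpos.le]
  refine mul_le_mul_of_nonneg_left ?_ hpos.le
  rw [← hl, ← hl', min_sub_sub_right]
  -- The signed deviation, with the sign frozen at `X`, minorizes the objective and equals it at
  -- `X`.
  have h1 := sign_mul_self_eq_abs (deviation a b f X t)
  have h2 := (sign_mul_le_abs (deviation a b f X t) (deviation a b f (X + α • g) t)).trans
    (abs_deviation_le_objective hf _ htI)
  set ε := Real.sign (deviation a b f X t)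
  rw [habs] at h1
  simp only [deviation, mul_sub] at h1 h2
  linarith

theorem spline_knot_eq_piece (hknots : ∀ l, l < N → knot a b X l < knot a b X (l + 1))
    (k : Fin N) :
    spline a b X (knot a b X k) = piece a b k X (knot a b X k) ∧
      spline a b X (knot a b X k) = piece a b (k + 1) X (knot a b X k) :=
  ⟨spline_eq_piece (fun _ h _ => knot_le_knot hknots h.le k.2.le)
      fun _ hi h => knot_le_knot hknots h hi.le,
    spline_eq_piece (fun _ h _ => knot_le_knot hknots (Nat.lt_succ_iff.1 h) k.2.le)
      fun _ hi h => knot_le_knot hknots (Nat.le_of_succ_le h) hi.le⟩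

/-- Near `X` the spline value at the knot is one of the two adjacent pieces, which bounds only the
minimum. This suffices for unstable knots, and for neutral ones, where the two gradients agree. -/
theorem min_inner_beta_knot_le (hf : ContinuousOn f (Icc a b))
    (hknots : ∀ l, l < N → knot a b X l < knot a b X (l + 1)) {g : Param m N} {L : ℝ}
    (hL : Tendsto (fun α : ℝ => α⁻¹ * (objective a b f (X + α • g) - objective a b f X))
      (𝓝[>] 0) (𝓝 L)) (k : Fin N) (ht : knot a b X k ∈ Kpos a b f X ∪ Kneg a b f X) :
    min (inner ℝ (beta a b f X k (knot a b X k)) g)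
      (inner ℝ (beta a b f X (k + 1) (knot a b X k)) g) ≤ L := by
  refine min_inner_beta_le hf hL ht (spline_knot_eq_piece hknots k).1
    (spline_knot_eq_piece hknots k).2 ?_
  filter_upwards [eventually_spline_eq_piece_knot hknots] with Y hY
  rcases hY with ⟨-, h⟩ | ⟨-, h⟩ <;> rw [h]
  exacts [min_le_right _ _, min_le_left _ _]

theorem inner_beta_le_of_esmooth (hf : ContinuousOn f (Icc a b))
    (hknots : ∀ l, l < N → knot a b X l < knot a b X (l + 1)) {g : Param m N} {L : ℝ}
    (hL : Tendsto (fun α : ℝ => α⁻¹ * (objective a b f (X + α • g) - objective a b f X))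
      (𝓝[>] 0) (𝓝 L)) {t : ℝ} (ht : t ∈ Esmooth a b f X) {j : ℕ} (hj1 : 1 ≤ j) (hjN : j ≤ N)
    (htj : t ∈ Icc (knot a b X (j - 1)) (knot a b X j)) :
    inner ℝ (beta a b f X j t) g ≤ L := by
  have hY : ∀ᶠ Y in 𝓝 X, spline a b Y t = piece a b j Y t := by
    refine eventually_spline_eq_piece (abs_deviation_of_mem ht.1).1.1 (fun i hi hij hiN => ?_)
      fun i hiN hji => ?_
    · exact ((knot_le_knot hknots (by omega) (by omega)).trans htj.1).lt_of_ne
        (ht.2 i hi hiN).symm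
    · exact (htj.2.trans (knot_le_knot hknots hji hiN.le)).lt_of_ne (ht.2 i (by omega) hiN)
  have h := min_inner_beta_le hf hL ht.1 hY.self_of_nhds hY.self_of_nhds
    (hY.mono fun Y h => by rw [h, min_self])
  rwa [min_self] at h

/-- Stable knots: both adjacent pieces bound the directional derivative. -/
theorem inner_beta_knot_le_of_eventually (hf : ContinuousOn f (Icc a b))
    (hknots : ∀ l, l < N → knot a b X l < knot a b X (l + 1)) {g : Param m N} {L : ℝ}
    (hL : Tendsto (fun α : ℝ => α⁻¹ * (objective a b f (X + α • g) - objective a b f X))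
      (𝓝[>] 0) (𝓝 L)) (k : Fin N) (ht : knot a b X k ∈ Kpos a b f X ∪ Kneg a b f X)
    {ε : ℝ} (hε : Real.sign (deviation a b f X (knot a b X k)) = ε)
    (h : ∀ᶠ Y in 𝓝 X,
      ε * piece a b k Y (knot a b X k) ≤ ε * spline a b Y (knot a b X k) ∧
      ε * piece a b (k + 1) Y (knot a b X k) ≤ ε * spline a b Y (knot a b X k)) :
    inner ℝ (beta a b f X k (knot a b X k)) g ≤ L ∧
      inner ℝ (beta a b f X (k + 1) (knot a b X k)) g ≤ L := by
  obtain ⟨h0, h1⟩ := spline_knot_eq_piece hknots k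
  subst hε
  constructor
  · simpa only [min_self] using min_inner_beta_le hf hL ht h0 h0
      (h.mono fun Y h => by rw [min_self]; exact h.1)
  · simpa only [min_self] using min_inner_beta_le hf hL ht h1 h1
      (h.mono fun Y h => by rw [min_self]; exact h.2)

/-- Positivity of the objective fixes the sign of the deviation at stable knots, where the signed
spline then dominates both signed pieces. -/
theorem inner_le_of_mem_gradSet (hm : 1 ≤ m) (hf : ContinuousOn f (Icc a b))
    (hknots : ∀ l, l < N → knot a b X l < knot a b X (l + 1)) {g : Param m N} {L : ℝ}
    (hL : Tendsto (fun α : ℝ => α⁻¹ * (objective a b f (X + α • g) - objective a b f X))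
      (𝓝[>] 0) (𝓝 L)) (hpos : 0 < objective a b f X) {v : Param m N}
    (hv : v ∈ gradSet a b f X univ) : inner ℝ v g ≤ L := by
  obtain ⟨t, ⟨ht, -⟩, j, hj1, hjN, htj, rfl⟩ := hv
  have hadj : ∀ k : Fin N, t = knot a b X k → j = k ∨ j = k + 1 := by
    rintro k rfl
    by_contra! hne
    rcases lt_or_gt_of_ne hne.1 with h | h
    · exact (knot_lt_knot hknots h k.2.le).not_ge htj.2
    · exact (knot_lt_knot hknots (i := k) (j := j - 1) (by omega) (by omega)).not_ge htj.1
  rcases ht with ((ht | ⟨ht, l, -, hlN, htl, hjump⟩) | ⟨ht, l, -, hlN, htl, hjump⟩) |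
    ⟨ht, l, -, hlN, htl, hjump⟩
  · exact inner_beta_le_of_esmooth hf hknots hL ht hj1 hjN htj
  · lift l to Fin N using hlN
    have hmin := min_inner_beta_knot_le hf hknots hL l (htl ▸ ht)
    have hβ := beta_succ_of_jump_eq_zero (a := a) (b := b) (f := f) hm l hjump
    rw [hβ, min_self] at hmin
    rcases hadj l htl with rfl | rfl <;> rw [htl]
    exacts [hmin, hβ ▸ hmin]
  · lift l to Fin N using hlN
    have h := inner_beta_knot_le_of_eventually hf hknots hL l (Or.inl (htl ▸ ht)) (ε := 1)
      (by rw [← htl, ht.2, Real.sign_of_pos hpos])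
      (by simpa only [one_mul] using eventually_piece_le_spline hm hknots hjump)
    rcases hadj l htl with rfl | rfl <;> rw [htl]
    exacts [h.1, h.2]
  · lift l to Fin N using hlN
    have h := inner_beta_knot_le_of_eventually hf hknots hL l (Or.inr (htl ▸ ht)) (ε := -1)
      (by rw [← htl, ht.2, Real.sign_of_neg (neg_lt_zero.2 hpos)])
      (by simpa only [neg_mul, one_mul, neg_le_neg_iff] using
        eventually_spline_le_piece hm hknots hjump)
    rcases hadj l htl with rfl | rfl <;> rw [htl]
    exacts [h.1, h.2]

theorem exists_mem_Delta_forall_inner_le (l : ℕ) (g : Param m N) :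
    ∃ d ∈ Delta a b f X l, (∀ e ∈ Delta a b f X l, inner ℝ d g ≤ inner ℝ e g) ∧
      inner ℝ d g = min (inner ℝ (beta a b f X l (knot a b X l)) g)
        (inner ℝ (beta a b f X (l + 1) (knot a b X l)) g) := by
  set u := beta a b f X l (knot a b X l)
  set v := beta a b f X (l + 1) (knot a b X l)
  have hbound : ∀ e ∈ Delta a b f X l, min (inner ℝ u g) (inner ℝ v g) ≤ inner ℝ e g := by
    have hc : Convex ℝ {e : Param m N | min (inner ℝ u g) (inner ℝ v g) ≤ inner ℝ e g} :=
      convex_halfSpace_ge ⟨fun x y => inner_add_left x y g,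
        fun c x => real_inner_smul_left x g c⟩ _
    refine fun e he => convexHull_min ?_ hc he
    rintro _ (rfl | rfl)
    · exact min_le_left (inner ℝ u g) (inner ℝ v g)
    · exact min_le_right (inner ℝ u g) (inner ℝ v g)
  rcases min_choice (inner ℝ u g : ℝ) (inner ℝ v g) with h | h
  · exact ⟨u, subset_convexHull _ _ (by simp [u]), fun e he => h ▸ hbound e he, h.symm⟩
  · exact ⟨v, subset_convexHull _ _ (by simp [v]), fun e he => h ▸ hbound e he, h.symm⟩

/-- At an inf-stationary spline, the directional derivatives of the objective function are
nonnegative. -/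
theorem InfStationary.derivative_nonneg (hm : 1 ≤ m) (hf : ContinuousOn f (Icc a b))
    (hknots : ∀ l, l < N → knot a b X l < knot a b X (l + 1)) (h : InfStationary a b f X)
    {g : Param m N} {L : ℝ}
    (hL : Tendsto (fun α : ℝ => α⁻¹ * (objective a b f (X + α • g) - objective a b f X))
      (𝓝[>] 0) (𝓝 L)) : 0 ≤ L := by
  -- If the objective vanishes, `X` is a global minimizer and the difference quotients are
  -- nonnegative.
  rcases (objective_nonneg (a := a) (b := b) (f := f) X).eq_or_lt with h0 | hpos
  · refine ge_of_tendsto hL ?_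
    filter_upwards [self_mem_nhdsWithin] with α hα
    rw [← h0, sub_zero]
    exact mul_nonneg (inv_nonneg.2 (le_of_lt hα)) (objective_nonneg _)
  choose d hd hdle hdeq using fun l => exists_mem_Delta_forall_inner_le (a := a) (b := b) (f := f)
    (X := X) l g
  set U := unstableIdx a b f X univ
  have hdL : ∀ l ∈ U, inner ℝ (d l) g ≤ L := by
    intro l hl
    simp only [U, unstableIdx, Finset.mem_filter, Finset.mem_Ico] at hl
    rw [hdeq]
    exact min_inner_beta_knot_le hf hknots hL ⟨l, hl.1.2⟩ (hl.2.2.imp And.left And.left)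
  have hsum : ∀ V : Finset ℕ, ∀ e ∈ superOf a b f X V,
      inner ℝ (∑ l ∈ V, d l) g ≤ inner ℝ e g := by
    intro V e he
    obtain ⟨e, heV, rfl⟩ := (Set.mem_finsetSum _ _ _).1 he
    rw [sum_inner, sum_inner]
    exact Finset.sum_le_sum fun l hl => hdle l _ (heV hl)
  -- The inclusion is tested at the sum of the minimizers `d l`. All generators of the
  -- subdifferential lie in the half-space `hc`, so this point does too, and the sums cancel to
  -- leave `0 ≤ L`.
  have hmem := h (show -∑ l ∈ U, d l ∈ -superdiff a b f X from
    Set.neg_mem_neg.2 ((Set.mem_finsetSum U (fun l => Delta a b f X l) _).2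
      ⟨d, fun {l} _ => hd l, rfl⟩))
  have hc : Convex ℝ {e : Param m N | inner ℝ e g ≤ L - inner ℝ (∑ l ∈ U, d l) g} :=
    convex_halfSpace_le ⟨fun x y => inner_add_left x y g, fun c x => real_inner_smul_left x g c⟩ _
  have hle := convexHull_min ?_ hc hmem
  · simp only [mem_ofPred_eq, inner_neg_left] at hle
    linarith
  rintro w (hw | hw)
  · obtain ⟨s, hs, e, he, rfl⟩ := hw
    have h1 := inner_le_of_mem_gradSet hm hf hknots hL hpos hs
    have h2 := hsum U e he
    simp only [mem_ofPred_eq, inner_sub_left]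
    linarith
  · obtain ⟨l, hl, hw⟩ := mem_iUnion₂.1 hw
    have h1 := hsum _ _ (Set.mem_neg.1 hw)
    have h2 := hdL l hl
    -- The summand missing from this generator is made up for by `⟪d l, g⟫ ≤ L`.
    rw [← Finset.add_sum_erase U d hl]
    simp only [mem_ofPred_eq, inner_add_left, inner_neg_left] at h1 ⊢
    linarith

end Derivative

end FreeKnotSpline

theorem mainTheorem3 (m N : ℕ) [NeZero N] (hm : 1 ≤ m) (a b : ℝ) (f : ℝ → ℝ)
    (hf : ContinuousOn f (Set.Icc a b)) (X : FreeKnotSpline.Param m N)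
    (hknots : ∀ l, l < N →
      FreeKnotSpline.knot a b X l < FreeKnotSpline.knot a b X (l + 1)) :
    (FreeKnotSpline.InfStationary a b f X ↔
      ∃ p q, p < q ∧ q ≤ N ∧ FreeKnotSpline.StationaryInterval a b f X p q) ∧
    (∀ A B : Set (FreeKnotSpline.Param m N),
      FreeKnotSpline.IsQuasidifferential (FreeKnotSpline.objective a b f) X A B →
        ((∃ p q, p < q ∧ q ≤ N ∧ FreeKnotSpline.StationaryInterval a b f X p q) → -B ⊆ A) ∧
        (FreeKnotSpline.IsQuasidifferential (FreeKnotSpline.objective a b f) X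
            (FreeKnotSpline.subdiff a b f X) (FreeKnotSpline.superdiff a b f X) →
          -B ⊆ A →
          ∃ p q, p < q ∧ q ≤ N ∧ FreeKnotSpline.StationaryInterval a b f X p q)) := by
  refine ⟨FreeKnotSpline.infStationary_iff hknots, fun A B hAB => ⟨fun h => ?_, fun hsub hBA => ?_⟩⟩
  · have hX := (FreeKnotSpline.infStationary_iff hknots).2 h
    exact hAB.neg_subset fun _ _ hL => hX.derivative_nonneg hm hf hknots hL
  -- Nonnegativity of the derivatives is read off from `[A, B]` and transferred to the explicit
  -- pair.
  · exact (FreeKnotSpline.infStationary_iff hknots).1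
      (hsub.neg_subset fun _ _ hL => hAB.derivative_nonneg hBA hL)
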